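/- Let $D$ be a division ring with center $F$. Assume that $D$ is non-commutative, that $D$ is algebraic over $F$ (every element of $D$ is a root of a nonzero polynomial with coefficients in $F$), and that $D$ is weakly locally finite: for every finite subset $S$ of $D$, the division subring $L$ of $D$ generated by $S$ is finite-dimensional as a vector space over its own center $Z(L)$. For $n\ge 1$ identify $F^*=F\setminus\{0\}$ with the subgroup $\{\alpha I : \alpha\in F^*\}$ of $\mathrm{GL}_n(D)$. Then: 1. For every $n\ge 1$, no subgroup $N$ of $\mathrm{GL}_n(D)$ containing $F^*$ is finitely generated. 2. For every $n\ge 1$, the group $\mathrm{GL}_n(D)$ is not finitely generated. 3. The multiplicative group $D^*$ is not finitely generated. 4. For every $n\ge 1$ and every subgroup $S$ of $\mathrm{GL}_n(D)$, if $N=F^*S=\{cs : c\in F^*,\ s\in S\}$ and $N'=[N,N]$ denotes the derived subgroup of $N$, then the abelian group $N/N'$ is not finitely generated. -/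

import Mathlib

/-- A division ring is centrally finite if it is a finite-dimensional vector space over its
center. -/
def IsCentrallyFinite (L : Type*) [DivisionRing L] : Prop :=
  Module.Finite (Subring.center L) L

/-- A division ring `D` is weakly locally finite if every finite subset of `D` generates a
centrally finite division subring. (Mathlib's `Subfield` of a division ring is a division
subring; it need not be commutative.) -/
def IsWeaklyLocallyFinite (D : Type*) [DivisionRing D] : Prop :=
  ∀ S : Set D, S.Finite → IsCentrallyFinite (Subfield.closure S)

/-- The group `F* I` of nonzero central scalar matrices in `GL_n(D)`, where `F` is the center
of `D`: the image of `F*` under `a ↦ a I`. -/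
def centralScalars (n : ℕ) (D : Type*) [DivisionRing D] :
    Subgroup (Matrix.GeneralLinearGroup (Fin n) D) :=
  ((Units.map (Matrix.scalar (Fin n) : D →+* Matrix (Fin n) (Fin n) D).toMonoidHom).comp
    (Units.map (Subring.center D).subtype.toMonoidHom)).range

/-! Everything reduces to the map from `Fˣ` to the abelianization of `N`, for `N` containing the
central scalars. Its kernel is torsion: a scalar `c` that is a product of commutators over `D` is
already one over some centrally finite `L`, where the norm from `M_n(L)` to `Z(L)` kills commutators
and sends `c` to a positive power of `c` (`isOfFinOrder_of_scalar_mem_commutator`).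

If the abelianization were finitely generated, `Fˣ` modulo torsion would have finite rank. Were `F`
not algebraic over a finite prime field, it would contain a copy of `ℤ` or `𝔽_p[t]`, whose
infinitely many pairwise coprime non-units are multiplicatively independent
(`exists_charP_isAlgebraic_zmod`). So `F`, and with it `D`, is algebraic over `𝔽_p`. Any two
elements of `D` then generate a finite division ring, which is commutative by Wedderburn's little
theorem: a contradiction. -/

/-! ### Finite rank of the multiplicative group of a field -/

/-- Pairwise coprime non-units of a commutative subring of a field are multiplicatively
independent. -/
theorem eq_zero_of_prod_zpow_eq_one {R F ι : Type*} [CommRing R] [Field F] {f : R →+* F}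
    (hf : Function.Injective f) {a : ι → R} (ha : Pairwise fun i j => IsCoprime (a i) (a j))
    (hau : ∀ i, ¬ IsUnit (a i)) {u : ι → Fˣ} (hu : ∀ i, (u i : F) = f (a i))
    {s : Finset ι} {g : ι → ℤ} (h : ∏ i ∈ s, u i ^ g i = 1) : ∀ i ∈ s, g i = 0 := by
  -- Since `toNat` truncates at zero, positive exponents stay on the left and negative ones move to
  -- the right. No index contributes to both sides, so the common value is coprime to itself, hence
  -- a unit.
  have heq : ∏ i ∈ s, a i ^ (g i).toNat = ∏ i ∈ s, a i ^ (-g i).toNat := by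
    apply hf
    have h1 : ∏ i ∈ s, u i ^ (g i).toNat = ∏ i ∈ s, u i ^ (-g i).toNat := by
      rw [← div_eq_one, ← Finset.prod_div_distrib, ← h]
      refine Finset.prod_congr rfl fun i _ => ?_
      rw [← zpow_natCast, ← zpow_natCast, div_eq_mul_inv, ← zpow_sub, Int.toNat_sub_toNat_neg]
    simpa [hu] using congrArg (Units.val) h1
  have hcop : IsCoprime (∏ i ∈ s, a i ^ (g i).toNat) (∏ i ∈ s, a i ^ (-g i).toNat) := by
    refine IsCoprime.prod_left fun i _ => IsCoprime.prod_right fun j _ => ?_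
    by_cases hij : i = j
    · subst hij
      rcases le_total (g i) 0 with h0 | h0
      · simp [Int.toNat_of_nonpos h0, isCoprime_one_left]
      · simp [Int.toNat_of_nonpos (neg_nonpos.2 h0), isCoprime_one_right]
    · exact (ha hij).pow
  have hun : IsUnit (∏ i ∈ s, a i ^ (g i).toNat) := by
    rw [← heq] at hcop
    exact isCoprime_self.1 hcop
  have key : ∀ (n : ι → ℕ), IsUnit (∏ i ∈ s, a i ^ n i) → ∀ i ∈ s, n i = 0 := by
    intro n hn i hi
    by_contra h0
    exact hau i ((isUnit_pow_iff h0).1 (isUnit_of_dvd_unit (Finset.dvd_prod_of_mem (fun i => a i ^ n i) hi) hn))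
  intro i hi
  have h1 := key _ hun i hi
  have h2 := key _ (heq ▸ hun) i hi
  omega

/-- The units of a field cannot map to a finitely generated abelian group with torsion kernel
if the field contains a ring with infinitely many pairwise coprime non-units. -/
theorem not_fg_of_pairwise_isCoprime {R F A : Type*} [CommRing R] [Field F] [CommGroup A]
    [Group.FG A] (φ : Fˣ →* A) (hφ : ∀ u, φ u = 1 → IsOfFinOrder u) {f : R →+* F}
    (hf : Function.Injective f) {a : ℕ → R} (ha : Pairwise fun i j => IsCoprime (a i) (a j))
    (hau : ∀ i, ¬ IsUnit (a i)) : False := by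
  have ha0 : ∀ i, f (a i) ≠ 0 := by
    intro i h0
    have h1 : a i = 0 := (map_eq_zero_iff f hf).1 h0
    have h2 : IsCoprime (a i) (a (i + 1)) := ha (Nat.succ_ne_self i).symm
    rw [h1, isCoprime_zero_left] at h2
    exact hau _ h2
  let u : ℕ → Fˣ := fun i => Units.mk0 _ (ha0 i)
  have : AddGroup.FG (Additive A) := GroupFG.iff_add_fg.1 inferInstance
  have : Module.Finite ℤ (Additive A) := Module.Finite.iff_addGroup_fg.2 this
  have hli : LinearIndependent ℤ fun i => Additive.ofMul (φ (u i)) := by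
    rw [linearIndependent_iff']
    intro s g hg
    have h1 : φ (∏ i ∈ s, u i ^ g i) = 1 := by
      rw [map_prod]
      simp only [map_zpow]
      exact hg
    -- A relation in `A` holds in `Fˣ` only up to torsion; multiplying all exponents by `k` makes it
    -- exact.
    obtain ⟨k, hk, h2⟩ := isOfFinOrder_iff_pow_eq_one.1 (hφ _ h1)
    have h3 : ∏ i ∈ s, u i ^ (g i * k) = 1 := by
      rw [← h2, ← Finset.prod_pow]
      exact Finset.prod_congr rfl fun i _ => by rw [zpow_mul, zpow_natCast]
    intro i hi
    have := eq_zero_of_prod_zpow_eq_one hf ha hau (u := u) (fun i => rfl) h3 i hi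
    simpa [hk.ne'] using this
  have := hli.finite_of_isNoetherian
  exact not_finite ℕ

/-- Iterating `y ↦ y * (y + 1)` produces a pairwise coprime sequence. -/
theorem pairwise_isCoprime_iterate_add_one {R : Type*} [CommRing R] (x : R) :
    Pairwise fun i j => IsCoprime ((fun y : R => y * (y + 1))^[i] x + 1)
      ((fun y : R => y * (y + 1))^[j] x + 1) := by
  set P : ℕ → R := fun i => (fun y : R => y * (y + 1))^[i] x with hP
  have hs : ∀ i, P (i + 1) = P i * (P i + 1) := fun i => by
    simp only [hP, Function.iterate_succ_apply']
  -- `P i + 1` divides every later `P j`, so `P j + 1` is congruent to 1 modulo it.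
  have hdvd : ∀ i k, P i + 1 ∣ P (i + 1 + k) := by
    intro i k
    induction k with
    | zero => exact ⟨P i, by rw [add_zero, hs, mul_comm]⟩
    | succ k ih => rw [← add_assoc, hs]; exact ih.mul_right _
  have hlt : ∀ i j, i < j → IsCoprime (P i + 1) (P j + 1) := by
    intro i j hij
    obtain ⟨k, rfl⟩ := Nat.exists_eq_add_of_lt hij
    obtain ⟨c, hc⟩ := hdvd i k
    have hc' : P (i + k + 1) = (P i + 1) * c := by rw [← hc]; congr 1; omega
    exact ⟨-c, 1, by rw [hc']; ring⟩
  intro i j hij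
  rcases lt_or_gt_of_ne hij with h | h
  · exact hlt i j h
  · exact (hlt j i h).symm

/-- A field whose multiplicative group modulo torsion is finitely generated is algebraic over a
finite prime field. -/
theorem exists_charP_isAlgebraic_zmod {F A : Type*} [Field F] [CommGroup A] [Group.FG A]
    (φ : Fˣ →* A) (hφ : ∀ u, φ u = 1 → IsOfFinOrder u) :
    ∃ p : ℕ, p.Prime ∧ ∃ _ : CharP F p, ∀ _ : Algebra (ZMod p) F,
      Algebra.IsAlgebraic (ZMod p) F := by
  obtain ⟨p, hp⟩ := CharP.exists F
  rcases CharP.char_is_prime_or_zero F p with hprime | rfl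
  · refine ⟨p, hprime, hp, fun _ => ⟨fun t => ?_⟩⟩
    by_contra ht
    have := Fact.mk hprime
    have hinj := transcendental_iff_injective.1 ht
    refine not_fg_of_pairwise_isCoprime φ hφ
      (f := (Polynomial.aeval (R := ZMod p) t).toRingHom) hinj
      (pairwise_isCoprime_iterate_add_one Polynomial.X) fun i => ?_
    have hdeg : 0 < ((fun y : Polynomial (ZMod p) => y * (y + 1))^[i] Polynomial.X).natDegree := by
      induction i with
      | zero => simp
      | succ i ih =>
        rw [Function.iterate_succ_apply', Polynomial.natDegree_mul']
        · omega
        · have h0 := Polynomial.ne_zero_of_natDegree_gt ih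
          refine mul_ne_zero (by simpa using h0) ?_
          rw [Ne, Polynomial.leadingCoeff_eq_zero]
          intro h
          rw [eq_neg_of_add_eq_zero_left h] at ih
          simp at ih
    refine Polynomial.not_isUnit_of_natDegree_pos _ ?_
    rwa [show (1 : Polynomial (ZMod p)) = Polynomial.C 1 by simp, Polynomial.natDegree_add_C]
  · have := CharP.charP_to_charZero F
    -- The starting value 1 keeps the iterates positive, so adding 1 gives integers at least 2; 0
    -- would be a fixed point.
    refine (not_fg_of_pairwise_isCoprime φ hφ (f := Int.castRingHom F) Int.cast_injective
      (pairwise_isCoprime_iterate_add_one 1) fun i => ?_).elim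
    have hpos : 0 < (fun y : ℤ => y * (y + 1))^[i] 1 := by
      induction i with
      | zero => simp
      | succ i ih => rw [Function.iterate_succ_apply']; positivity
    rw [Int.isUnit_iff]
    omega

/-! ### Central scalars that are products of commutators -/

/-- A central element of a centrally finite division ring whose scalar matrix is a product of
commutators has finite order. -/
theorem isOfFinOrder_of_scalar_mem_commutator {L : Type*} [DivisionRing L]
    (hL : IsCentrallyFinite L) {n : ℕ} (hn : 1 ≤ n) {c : Lˣ} (hc : (c : L) ∈ Subring.center L)
    (h : Units.map (Matrix.scalar (Fin n) : L →+* Matrix (Fin n) (Fin n) L).toMonoidHom c ∈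
      commutator (Matrix.GeneralLinearGroup (Fin n) L)) : IsOfFinOrder c := by
  have : Module.Finite (Subring.center L) L := hL
  have : NeZero n := ⟨by omega⟩
  let K := Subring.center L
  let M := Matrix (Fin n) (Fin n) L
  -- The norm takes values in the commutative group `Kˣ`, so it is trivial on commutators.
  have h1 := Abelianization.commutator_subset_ker (Units.map (Algebra.norm K : M →* K)) h
  rw [MonoidHom.mem_ker, Units.ext_iff] at h1
  have h2 : Algebra.norm K (algebraMap K M ⟨c, hc⟩) = 1 := h1
  rw [Algebra.norm_algebraMap] at h2
  refine isOfFinOrder_iff_pow_eq_one.2 ⟨Module.finrank K M, Module.finrank_pos, ?_⟩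
  ext
  simpa using congrArg Subtype.val h2

/-- Every product of commutators of matrices over a division ring is a product of commutators over
a finitely generated division subring. -/
theorem exists_finite_mem_map_commutator {D : Type*} [DivisionRing D] {n : ℕ}
    {g : Matrix.GeneralLinearGroup (Fin n) D}
    (hg : g ∈ commutator (Matrix.GeneralLinearGroup (Fin n) D)) :
    ∃ S : Set D, S.Finite ∧ ∀ L : Subfield D, S ⊆ L →
      g ∈ (commutator (Matrix.GeneralLinearGroup (Fin n) L)).map
        (Units.map L.subtype.mapMatrix.toMonoidHom) := by
  have hlift : ∀ a : Matrix.GeneralLinearGroup (Fin n) D, ∃ S : Set D, S.Finite ∧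
      ∀ L : Subfield D, S ⊆ L → ∃ b : Matrix.GeneralLinearGroup (Fin n) L,
        Units.map L.subtype.mapMatrix.toMonoidHom b = a := by
    intro a
    -- The entries of the inverse are included so that the lifted matrix is invertible over `L`.
    refine ⟨Set.range (fun p : Fin n × Fin n => (a : Matrix (Fin n) (Fin n) D) p.1 p.2) ∪
      Set.range (fun p : Fin n × Fin n => ((a⁻¹ :) : Matrix (Fin n) (Fin n) D) p.1 p.2),
      (Set.finite_range _).union (Set.finite_range _), fun L hL => ?_⟩
    have h1 : ∀ i j, (a : Matrix (Fin n) (Fin n) D) i j ∈ L := fun i j =>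
      hL (Or.inl ⟨(i, j), rfl⟩)
    have h2 : ∀ i j, ((a⁻¹ :) : Matrix (Fin n) (Fin n) D) i j ∈ L := fun i j =>
      hL (Or.inr ⟨(i, j), rfl⟩)
    have hinj : Function.Injective (L.subtype.mapMatrix (m := Fin n)) :=
      Matrix.map_injective L.subtype.injective
    let b : Matrix (Fin n) (Fin n) L := Matrix.of fun i j => ⟨_, h1 i j⟩
    let b' : Matrix (Fin n) (Fin n) L := Matrix.of fun i j => ⟨_, h2 i j⟩
    have hb : L.subtype.mapMatrix b = (a : Matrix (Fin n) (Fin n) D) := rfl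
    have hb' : L.subtype.mapMatrix b' = ((a⁻¹ :) : Matrix (Fin n) (Fin n) D) := rfl
    refine ⟨⟨b, b', hinj ?_, hinj ?_⟩, Units.ext hb⟩
    · rw [map_mul, map_one, hb, hb', Units.mul_inv]
    · rw [map_mul, map_one, hb, hb', Units.inv_mul]
  rw [commutator_eq_closure] at hg
  induction hg using Subgroup.closure_induction with
  | mem x hx =>
    obtain ⟨a, b, rfl⟩ := hx
    obtain ⟨S, hS, hSL⟩ := hlift a
    obtain ⟨T, hT, hTL⟩ := hlift b
    refine ⟨S ∪ T, hS.union hT, fun L hL => ?_⟩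
    obtain ⟨a', rfl⟩ := hSL L (Set.subset_union_left.trans hL)
    obtain ⟨b', rfl⟩ := hTL L (Set.subset_union_right.trans hL)
    rw [← map_commutatorElement]
    exact Subgroup.mem_map_of_mem _
      (Subgroup.commutator_mem_commutator (Subgroup.mem_top _) (Subgroup.mem_top _))
  | one => exact ⟨∅, Set.finite_empty, fun L _ => one_mem _⟩
  | mul x y _ _ hx hy =>
    obtain ⟨S, hS, hSL⟩ := hx
    obtain ⟨T, hT, hTL⟩ := hy
    exact ⟨S ∪ T, hS.union hT, fun L hL => mul_mem (hSL L (Set.subset_union_left.trans hL))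
      (hTL L (Set.subset_union_right.trans hL))⟩
  | inv x _ hx =>
    obtain ⟨S, hS, hSL⟩ := hx
    exact ⟨S, hS, fun L hL => inv_mem (hSL L hL)⟩

/-- In a weakly locally finite division ring, a central unit whose scalar matrix is a product of
commutators has finite order. -/
theorem IsWeaklyLocallyFinite.isOfFinOrder_of_scalar_mem_commutator {D : Type*} [DivisionRing D]
    (hD : IsWeaklyLocallyFinite D) {n : ℕ} (hn : 1 ≤ n) {c : Dˣ}
    (hc : (c : D) ∈ Subring.center D)
    (h : Units.map (Matrix.scalar (Fin n) : D →+* Matrix (Fin n) (Fin n) D).toMonoidHom c ∈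
      commutator (Matrix.GeneralLinearGroup (Fin n) D)) : IsOfFinOrder c := by
  obtain ⟨S, hS, hSL⟩ := exists_finite_mem_map_commutator h
  obtain ⟨L, hL, hSL'⟩ : ∃ L : Subfield D, IsCentrallyFinite L ∧ S ⊆ L :=
    ⟨Subfield.closure S, hD S hS, Subfield.subset_closure⟩
  obtain ⟨g, hg, hgc⟩ := hSL L hSL'
  have hgc' : ∀ i j, ((g : Matrix (Fin n) (Fin n) L) i j : D) =
      Matrix.scalar (Fin n) (c : D) i j := fun i j =>
    congrArg (fun u : Matrix.GeneralLinearGroup (Fin n) D =>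
      (u : Matrix (Fin n) (Fin n) D) i j) hgc
  have hcL : (c : D) ∈ L := by
    have := hgc' ⟨0, hn⟩ ⟨0, hn⟩
    rw [Matrix.scalar_apply, Matrix.diagonal_apply_eq] at this
    rw [← this]
    exact Subtype.property _
  let c' : Lˣ := Units.mk0 ⟨c, hcL⟩ fun h0 => c.ne_zero (congrArg Subtype.val h0)
  have hc' : (c' : L) ∈ Subring.center L := by
    rw [Subring.mem_center_iff] at hc ⊢
    exact fun x => Subtype.ext (hc x)
  have hgs : Units.map (Matrix.scalar (Fin n) : L →+* Matrix (Fin n) (Fin n) L).toMonoidHom c' =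
      g := by
    ext i j
    refine Eq.trans ?_ (hgc' i j).symm
    by_cases hij : i = j
    · subst hij; simp [c']
    · simp [hij]
  obtain ⟨k, hk, hck⟩ := isOfFinOrder_iff_pow_eq_one.1
    (_root_.isOfFinOrder_of_scalar_mem_commutator hL hn hc' (hgs ▸ hg))
  refine isOfFinOrder_iff_pow_eq_one.2 ⟨k, hk, ?_⟩
  ext
  simpa [c'] using congrArg (fun u : Lˣ => ((u : L) : D)) hck

/-! ### Finiteness and commutativity over a finite field -/

/-- A division ring that is generated by a finite set, finite-dimensional over its center and
algebraic over a finite field is finite. -/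
theorem IsCentrallyFinite.finite_of_isAlgebraic {L k : Type*} [DivisionRing L] [Field k] [Finite k]
    (hL : IsCentrallyFinite L) [Algebra k (Subring.center L)]
    [Algebra.IsAlgebraic k (Subring.center L)]
    {S : Set L} (hS : S.Finite) (hgen : Subfield.closure S = ⊤) : Finite L := by
  classical
  let K := Subring.center L
  have : Module.Finite K L := hL
  let b := Module.finBasis K L
  let m := Module.finrank K L
  -- The structure constants of `b`, and the coordinates of the generators and of 1. They generate a
  -- finite ring `A`, being finitely many elements integral over `k`; the elements with coordinates
  -- in `A` then form a finite subring.
  let C : Set K := (Set.range fun p : Fin m × Fin m × Fin m => b.repr (b p.1 * b p.2.1) p.2.2) ∪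
    ((fun q : L × Fin m => b.repr q.1 q.2) '' (insert 1 S) ×ˢ Set.univ)
  have hC : C.Finite := (Set.finite_range _).union
    (((hS.insert 1).prod Set.finite_univ).image _)
  let A := Algebra.adjoin k C
  have hAfin : Finite A := by
    have : Module.Finite k A := Module.Finite.iff_fg.2
      (fg_adjoin_of_finite hC fun x _ => Algebra.IsIntegral.isIntegral x)
    exact Module.finite_of_finite k
  have hmul : ∀ i j l, b.repr (b i * b j) l ∈ A := fun i j l =>
    Algebra.subset_adjoin (Or.inl ⟨(i, j, l), rfl⟩)
  have hins : ∀ x ∈ insert 1 S, ∀ l, b.repr x l ∈ A := fun x hx l =>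
    Algebra.subset_adjoin (Or.inr ⟨(x, l), ⟨hx, Set.mem_univ _⟩, rfl⟩)
  let R : Subring L :=
    { carrier := {x | ∀ l, b.repr x l ∈ A}
      mul_mem' := by
        intro x y hx hy l
        have : x * y = ∑ i, ∑ j, (b.repr x i * b.repr y j) • (b i * b j) := by
          conv_lhs => rw [← b.sum_repr x, ← b.sum_repr y]
          simp only [Finset.sum_mul, Finset.mul_sum, smul_mul_smul_comm]
          exact Finset.sum_comm
        rw [this]
        simp only [map_sum, map_smul, Finsupp.coe_finsetSum, Finset.sum_apply, Finsupp.smul_apply,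
          smul_eq_mul]
        exact sum_mem fun i _ => sum_mem fun j _ => mul_mem (mul_mem (hx i) (hy j)) (hmul i j l)
      one_mem' := hins 1 (Set.mem_insert _ _)
      add_mem' := fun hx hy l => by
        rw [map_add, Finsupp.add_apply]; exact add_mem (hx l) (hy l)
      zero_mem' := fun l => by simp
      neg_mem' := fun hx l => by
        rw [map_neg, Finsupp.neg_apply]; exact neg_mem (hx l) }
  have hRfin : Finite R := by
    refine Finite.of_injective (fun (x : R) (l : Fin m) => (⟨b.repr x l, x.2 l⟩ : A)) ?_
    intro x y hxy
    refine Subtype.ext (b.repr.injective (Finsupp.ext fun l => ?_))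
    exact congrArg Subtype.val (congrFun hxy l)
  -- A finite domain has inverses, so `R` is a division subring containing `S`, hence all of `L`.
  have hfield := Finite.isDomain_to_isField R
  let T : Subfield L :=
    { R with
      inv_mem' := by
        intro x hx
        by_cases h0 : x = 0
        · rw [h0, inv_zero]; exact R.zero_mem
        obtain ⟨y, hy⟩ := hfield.mul_inv_cancel (a := ⟨x, hx⟩)
          (fun h => h0 (congrArg Subtype.val h))
        have : x⁻¹ = y := inv_eq_of_mul_eq_one_right (congrArg Subtype.val hy)
        rw [this]
        exact y.2 }
  have hT : ∀ x : L, x ∈ R := by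
    have h1 : Subfield.closure S ≤ T := Subfield.closure_le.2 fun x hx =>
      hins x (Set.mem_insert_of_mem _ hx)
    rw [hgen] at h1
    exact fun x => h1 (Subfield.mem_top x)
  exact Finite.of_injective (fun x : L => (⟨x, hT x⟩ : R)) fun x y h => congrArg Subtype.val h

/-- A weakly locally finite division ring that is algebraic over a finite prime field is
commutative. -/
theorem IsWeaklyLocallyFinite.mul_comm_of_isAlgebraic_zmod {D : Type*} [DivisionRing D]
    (hD : IsWeaklyLocallyFinite D) {p : ℕ} [Fact p.Prime] [Algebra (ZMod p) D]
    [Algebra.IsAlgebraic (ZMod p) D] (x y : D) : x * y = y * x := by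
  have hxy : ({x, y} : Set D).Finite := Set.toFinite _
  obtain ⟨L, hL, hLgen⟩ : ∃ L : Subfield D, IsCentrallyFinite L ∧ L = Subfield.closure {x, y} :=
    ⟨_, hD _ hxy, rfl⟩
  have hx : x ∈ L := hLgen ▸ Subfield.subset_closure (by simp)
  have hy : y ∈ L := hLgen ▸ Subfield.subset_closure (by simp)
  let i : Subring.center L →+* D := L.subtype.comp (Subring.center L).subtype
  have hi : Function.Injective i := L.subtype.injective.comp Subtype.val_injective
  have : CharP D p := charP_of_injective_algebraMap (algebraMap (ZMod p) D).injective p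
  have : CharP (Subring.center L) p := i.charP hi p
  let _ : Algebra (ZMod p) (Subring.center L) := ZMod.algebra _ p
  have : Algebra.IsAlgebraic (ZMod p) (Subring.center L) := by
    have hij : i.comp (algebraMap (ZMod p) _) = algebraMap (ZMod p) D := Subsingleton.elim _ _
    let j : Subring.center L →ₐ[ZMod p] D :=
      { i with commutes' := fun r => RingHom.congr_fun hij r }
    exact ⟨fun z => (isAlgebraic_algHom_iff j hi).1 (Algebra.IsAlgebraic.isAlgebraic (j z))⟩
  have hgen : Subfield.closure ({⟨x, hx⟩, ⟨y, hy⟩} : Set L) = ⊤ := by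
    rw [eq_top_iff]
    have h1 : L ≤ (Subfield.closure ({⟨x, hx⟩, ⟨y, hy⟩} : Set L)).map L.subtype := by
      conv_lhs => rw [hLgen]
      refine Subfield.closure_le.2 ?_
      rintro z (rfl | rfl)
      · exact ⟨⟨z, hx⟩, Subfield.subset_closure (by simp), rfl⟩
      · exact ⟨⟨z, hy⟩, Subfield.subset_closure (by simp), rfl⟩
    intro z _
    obtain ⟨w, hw, hwz⟩ := h1 z.2
    rwa [← show w = z from Subtype.ext hwz]
  have : Finite L := hL.finite_of_isAlgebraic (k := ZMod p) (Set.toFinite _) hgen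
  exact congrArg Subtype.val ((Finite.isDomain_to_isField L).mul_comm ⟨x, hx⟩ ⟨y, hy⟩)

/-! ### Abelianizations and the main theorem -/

/-- In a non-commutative algebraic weakly locally finite division ring, no subgroup of the general
linear group containing the central scalars has a finitely generated abelianization. -/
theorem not_fg_abelianization_of_centralScalars_le {D : Type*} [DivisionRing D]
    (hnc : ∃ x y : D, x * y ≠ y * x) (halg : Algebra.IsAlgebraic (Subring.center D) D)
    (hwlf : IsWeaklyLocallyFinite D) {n : ℕ} (hn : 1 ≤ n)
    {N : Subgroup (Matrix.GeneralLinearGroup (Fin n) D)} (hN : centralScalars n D ≤ N) :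
    ¬ Group.FG (Abelianization N) := by
  intro hfg
  let e : (Subring.center D)ˣ →* Dˣ := Units.map (Subring.center D).subtype.toMonoidHom
  let σ : Dˣ →* Matrix.GeneralLinearGroup (Fin n) D :=
    Units.map (Matrix.scalar (Fin n) : D →+* Matrix (Fin n) (Fin n) D).toMonoidHom
  let φ : (Subring.center D)ˣ →* Abelianization N :=
    Abelianization.of.comp ((σ.comp e).codRestrict N fun u => hN ⟨u, rfl⟩)
  have hφ : ∀ u, φ u = 1 → IsOfFinOrder u := by
    intro u hu
    have h1 : (σ.comp e).codRestrict N (fun u => hN ⟨u, rfl⟩) u ∈ commutator N :=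
      (QuotientGroup.eq_one_iff _).1 hu
    have h2 : σ (e u) ∈ commutator (Matrix.GeneralLinearGroup (Fin n) D) := by
      -- Only the inclusion of `[N, N]` in the derived subgroup of the full linear group is needed.
      have h3 := Subgroup.mem_map_of_mem N.subtype h1
      rw [Subgroup.map_subtype_commutator] at h3
      exact Subgroup.commutator_mono le_top le_top h3
    have h4 := hwlf.isOfFinOrder_of_scalar_mem_commutator hn (u : Subring.center D).2 h2
    exact (Units.map_injective (f := (Subring.center D).subtype.toMonoidHom)
      Subtype.val_injective).isOfFinOrder_iff.1 h4
  obtain ⟨p, hp, hchar, hF⟩ := exists_charP_isAlgebraic_zmod φ hφ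
  have := Fact.mk hp
  let _ : Algebra (ZMod p) (Subring.center D) := ZMod.algebra _ p
  have := hF inferInstance
  let _ : Algebra (ZMod p) D :=
    ((algebraMap (Subring.center D) D).comp (algebraMap (ZMod p) (Subring.center D))).toAlgebra'
      fun c x => (Subring.mem_center_iff.1
        (algebraMap (ZMod p) (Subring.center D) c).2 x).symm
  have := IsScalarTower.of_algebraMap_eq (R := ZMod p) (S := Subring.center D) (A := D)
    fun _ => rfl
  have : Algebra.IsAlgebraic (ZMod p) D := Algebra.IsAlgebraic.trans (ZMod p) (Subring.center D) D
  obtain ⟨x, y, hxy⟩ := hnc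
  exact hxy (hwlf.mul_comm_of_isAlgebraic_zmod (p := p) x y)

theorem theorem9p3 (D : Type*) [DivisionRing D]
    (hnc : ∃ x y : D, x * y ≠ y * x)
    (halg : Algebra.IsAlgebraic (Subring.center D) D)
    (hwlf : IsWeaklyLocallyFinite D) :
    (∀ n : ℕ, 1 ≤ n → ∀ N : Subgroup (Matrix.GeneralLinearGroup (Fin n) D),
      centralScalars n D ≤ N → ¬ N.FG) ∧
    (∀ n : ℕ, 1 ≤ n → ¬ Group.FG (Matrix.GeneralLinearGroup (Fin n) D)) ∧
    ¬ Group.FG Dˣ ∧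
    (∀ n : ℕ, 1 ≤ n → ∀ S N : Subgroup (Matrix.GeneralLinearGroup (Fin n) D),
      {g | g ∈ N} = {g | ∃ c ∈ centralScalars n D, ∃ s ∈ S, g = c * s} →
      ¬ Group.FG (N ⧸ commutator N)) := by
  have hsub : ∀ n : ℕ, 1 ≤ n → ∀ N : Subgroup (Matrix.GeneralLinearGroup (Fin n) D),
      centralScalars n D ≤ N → ¬ N.FG := by
    intro n hn N hN hfg
    have : Group.FG N := (Group.fg_iff_subgroup_fg N).2 hfg
    exact not_fg_abelianization_of_centralScalars_le hnc halg hwlf hn hN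
      (QuotientGroup.fg (commutator N))
  have hGL : ∀ n : ℕ, 1 ≤ n → ¬ Group.FG (Matrix.GeneralLinearGroup (Fin n) D) :=
    fun n hn hfg => hsub n hn ⊤ le_top hfg.out
  refine ⟨hsub, hGL, fun hfg => hGL 1 le_rfl ?_, fun n hn S N hNS => ?_⟩
  -- `GL_1(D)` is isomorphic to `Dˣ`.
  · exact Group.fg_of_surjective
      (f := (Units.mapEquiv
        (Matrix.uniqueRingEquiv (m := Fin 1) (A := D)).symm.toMulEquiv).toMonoidHom)
      (Units.mapEquiv _).surjective
  · refine not_fg_abelianization_of_centralScalars_le hnc halg hwlf hn fun c hc => ?_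
    -- Taking `s = 1` shows that `F*S` contains `F*`.
    exact hNS.ge ⟨c, hc, 1, S.one_mem, (mul_one c).symm⟩
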